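/- Let $X$ be a positive definite metric space, i.e. for every finite $F\subseteq X$ the matrix $(e^{-d(x,y)})_{x,y\in F}$ is (strictly) positive definite. Let $\mathcal W_X$ be the Hilbert space completion of the space of finitely supported signed measures $\sum_x w_x\delta_x$ on $X$ with respect to the inner product $$\Big\langle \sum_x w_x\delta_x,\ \sum_y v_y\delta_y\Big\rangle_{\mathcal W_X}=\sum_{x,y} w_x v_y e^{-d(x,y)} .$$ For a nonempty finite $F\subseteq X$, let the maximum diversity $|F|_+$ be the maximum of $$\frac{\big(\sum_{x} w_x\big)^2}{\sum_{x,y} e^{-d(x,y)}w_xw_y}$$ over all nonzero measures $w=\sum_{x\in F} w_x\delta_x$ with all $w_x\ge 0$, and let the diversifier $w_{F,+}$ be the unique maximizer with $\sum_x w_x=|F|_+$; put $|\emptyset|_+=0$ and $w_{\emptyset,+}=0$. For a compact set $A\subseteq X$ let $$|A|_+=\sup\{|F|_+ : F\subseteq A \text{ finite}\}\in[0,\infty],\qquad w_{A,+}=\lim_{F} w_{F,+}\in\mathcal W_X,$$ where the limit is taken over the finite subsets $F$ of $A$ directed by inclusion. Then, for any two compact subsets $A,B$ of $X$, the maximum diversities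 $|A|_+$, $|B|_+$, $|A\cup B|_+$ are finite, the limits defining $w_{A,+}$ and $w_{B,+}$ exist in $\mathcal W_X$, and $$\|w_{A,+}-w_{B,+}\|_{\mathcal W_X}\le\sqrt{|A\cup B|_+-|A|_+}+\sqrt{|A\cup B|_+-|B|_+}\,.$$ -/

import Mathlib

noncomputable section

namespace Diversity

/-- The similarity matrix `(e^{-d(x,y)})` of a finite subset `B` of a metric space. -/
def similarityMatrix {X : Type*} [MetricSpace X] (B : Finset X) : Matrix B B ℝ :=
  Matrix.of fun x y => Real.exp (-dist (x : X) (y : X))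

/-- A metric space is positive definite if the similarity matrix of each of its finite subsets
is (strictly) positive definite. -/
class PositiveDefiniteSpace (X : Type*) [MetricSpace X] : Prop where
  posDef : ∀ B : Finset X, (similarityMatrix B).PosDef

/-- `⟨w, 1⟩`, the total mass of the finitely supported signed measure `∑ w x • δ_x`. -/
def mass {X : Type*} (w : X →₀ ℝ) : ℝ := w.sum fun _ a => a

/-- `⟨w, v⟩_W = ∑ w x * v y * e^{-d(x,y)}` for finitely supported signed measures. -/
def similarityForm {X : Type*} [MetricSpace X] (w v : X →₀ ℝ) : ℝ :=
  w.sum fun x a => v.sum fun y b => a * b * Real.exp (-dist x y)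

theorem similarityForm_comm {X : Type*} [MetricSpace X] (w v : X →₀ ℝ) :
    similarityForm w v = similarityForm v w := by
  unfold similarityForm Finsupp.sum
  rw [Finset.sum_comm]
  refine Finset.sum_congr rfl fun y _ => Finset.sum_congr rfl fun x _ => ?_
  change w x * v y * _ = v y * w x * _
  rw [dist_comm, mul_comm (w x)]

theorem similarityForm_add_left {X : Type*} [MetricSpace X] (u w v : X →₀ ℝ) :
    similarityForm (u + w) v = similarityForm u v + similarityForm w v := by
  classical
  unfold similarityForm
  rw [Finsupp.sum_add_index']
  · intro x; simp
  · intro x a b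
    simp only [Finsupp.sum, ← Finset.sum_add_distrib]
    exact Finset.sum_congr rfl fun y _ => by ring

theorem similarityForm_smul_left {X : Type*} [MetricSpace X] (c : ℝ) (w v : X →₀ ℝ) :
    similarityForm (c • w) v = c * similarityForm w v := by
  unfold similarityForm
  rw [Finsupp.sum_smul_index (fun x => by simp)]
  simp only [Finsupp.sum, Finset.mul_sum]
  exact Finset.sum_congr rfl fun x _ => Finset.sum_congr rfl fun y _ => by ring

theorem similarityForm_eq_sum {X : Type*} [MetricSpace X] {B : Finset X} {w : X →₀ ℝ}
    (hw : w.support ⊆ B) :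
    similarityForm w w = ∑ x : B, ∑ y : B, w x * w y * Real.exp (-dist (x : X) (y : X)) := by
  unfold similarityForm
  rw [Finsupp.sum_of_support_subset _ hw _ (by simp), ← Finset.sum_coe_sort B]
  refine Finset.sum_congr rfl fun x _ => ?_
  rw [Finsupp.sum_of_support_subset _ hw _ (by simp), ← Finset.sum_coe_sort B]

theorem mass_eq_sum {X : Type*} {B : Finset X} {w : X →₀ ℝ} (hw : w.support ⊆ B) :
    mass w = ∑ x : B, w x := by
  unfold mass
  rw [Finsupp.sum_of_support_subset _ hw _ (by simp), ← Finset.sum_coe_sort B]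

theorem similarityForm_self_pos {X : Type*} [MetricSpace X] [PositiveDefiniteSpace X]
    {w : X →₀ ℝ} (hw : w ≠ 0) : 0 < similarityForm w w := by
  have hx : (fun x : w.support => w x) ≠ 0 := by
    intro h
    apply hw
    ext x
    by_contra hx
    exact hx (congrFun h ⟨x, Finsupp.mem_support_iff.2 hx⟩)
  have h := (PositiveDefiniteSpace.posDef w.support).dotProduct_mulVec_pos hx
  rw [similarityForm_eq_sum (subset_refl w.support)]
  refine lt_of_lt_of_eq h ?_
  simp only [dotProduct, Matrix.mulVec, Finset.mul_sum, similarityMatrix, Matrix.of_apply,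
    Pi.star_apply, star_trivial]
  exact Finset.sum_congr rfl fun x _ => Finset.sum_congr rfl fun y _ => by ring

/-- The objective function `⟨w, 1⟩² / ⟨w, w⟩_W`. -/
def diversityRatio {X : Type*} [MetricSpace X] (w : X →₀ ℝ) : ℝ :=
  mass w ^ 2 / similarityForm w w

/-- The feasible set: nonzero nonnegative measures supported on the finite set `B`. -/
def feasible {X : Type*} (B : Finset X) : Set (X →₀ ℝ) :=
  {w | w.support ⊆ B ∧ 0 ≤ w ∧ w ≠ 0}

/-- The maximum diversity of a finite set: the maximum of the objective function over the
feasible set (it is attained, see `exists_isMaxOn`; the value at the empty set is `0`). -/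
def finiteMaxDiversity {X : Type*} [MetricSpace X] (B : Finset X) : ℝ :=
  sSup (diversityRatio '' feasible B)

/-- `w` is the diversifier of the finite set `B`: a maximizer of the objective function over the
feasible set, normalized by `⟨w, 1⟩ = |B|_+`. The empty set, for which the feasible set is empty,
has the zero measure as its diversifier. -/
def IsFiniteDiversifier {X : Type*} [MetricSpace X] (B : Finset X) (w : X →₀ ℝ) : Prop :=
  (B.Nonempty → w ∈ feasible B ∧ IsMaxOn diversityRatio (feasible B) w ∧
    mass w = finiteMaxDiversity B) ∧ (B = ∅ → w = 0)

theorem mass_pos {X : Type*} {B : Finset X} {w : X →₀ ℝ} (hw : w ∈ feasible B) : 0 < mass w := by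
  obtain ⟨-, h0, hne⟩ := hw
  obtain ⟨x, hx⟩ := Finsupp.support_nonempty_iff.2 hne
  exact Finset.sum_pos (fun y hy => lt_of_le_of_ne (h0 y) (Finsupp.mem_support_iff.1 hy).symm)
    ⟨x, hx⟩

theorem mass_smul {X : Type*} (c : ℝ) (w : X →₀ ℝ) : mass (c • w) = c * mass w := by
  unfold mass
  rw [Finsupp.sum_smul_index (fun _ => rfl), Finsupp.sum, Finsupp.sum, Finset.mul_sum]

theorem mass_add {X : Type*} (u w : X →₀ ℝ) : mass (u + w) = mass u + mass w := by
  classical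
  exact Finsupp.sum_add_index' (fun _ => rfl) (fun _ _ _ => rfl)

theorem similarityForm_smul_smul {X : Type*} [MetricSpace X] (c : ℝ) (w : X →₀ ℝ) :
    similarityForm (c • w) (c • w) = c ^ 2 * similarityForm w w := by
  rw [similarityForm_smul_left, similarityForm_comm, similarityForm_smul_left]
  ring

theorem diversityRatio_smul {X : Type*} [MetricSpace X] {c : ℝ} (hc : c ≠ 0) (w : X →₀ ℝ) :
    diversityRatio (c • w) = diversityRatio w := by
  unfold diversityRatio
  rw [mass_smul, similarityForm_smul_smul, mul_pow, mul_div_mul_left _ _ (pow_ne_zero 2 hc)]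

theorem smul_mem_feasible {X : Type*} {B : Finset X} {c : ℝ} (hc : 0 < c) {w : X →₀ ℝ}
    (hw : w ∈ feasible B) : c • w ∈ feasible B :=
  ⟨Finsupp.support_smul.trans hw.1, fun x => mul_nonneg hc.le (hw.2.1 x),
    smul_ne_zero hc.ne' hw.2.2⟩

/-- The optimization problem has a solution. -/
theorem exists_isMaxOn {X : Type*} [MetricSpace X] [PositiveDefiniteSpace X] {B : Finset X}
    (hB : B.Nonempty) : ∃ w ∈ feasible B, IsMaxOn diversityRatio (feasible B) w := by
  classical
  let Q : (B → ℝ) → ℝ := fun p => ∑ x : B, ∑ y : B, p x * p y * Real.exp (-dist (x : X) (y : X))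
  let E : (B → ℝ) → (X →₀ ℝ) := fun p => Finsupp.indicator B fun x hx => p ⟨x, hx⟩
  have hEs (p : B → ℝ) : (E p).support ⊆ B := Finsupp.support_indicator_subset _ _
  have hE (p : B → ℝ) (x : B) : E p x = p x := Finsupp.indicator_of_mem x.2 _
  have hQ (p : B → ℝ) : similarityForm (E p) (E p) = Q p := by
    rw [similarityForm_eq_sum (hEs p)]; simp only [hE, Q]
  have hm (p : B → ℝ) (hp : p ∈ stdSimplex ℝ B) : mass (E p) = 1 := by
    rw [mass_eq_sum (hEs p), ← hp.2]; simp only [hE]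
  have hEf (p : B → ℝ) (hp : p ∈ stdSimplex ℝ B) : E p ∈ feasible B := by
    refine ⟨hEs p, fun x => ?_, fun h => ?_⟩
    · by_cases hx : x ∈ B
      · exact (hp.1 ⟨x, hx⟩).trans_eq (hE p ⟨x, hx⟩).symm
      · exact (Finsupp.indicator_of_notMem hx _).ge
    · have := hm p hp
      rw [h] at this
      simp [mass] at this
  have : Nonempty B := hB.to_subtype
  obtain ⟨p, hp, hmin⟩ := (isCompact_stdSimplex ℝ B).exists_isMinOn
    ⟨_, single_mem_stdSimplex ℝ (Classical.arbitrary B)⟩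
    (f := Q) (by fun_prop)
  refine ⟨E p, hEf p hp, fun v hv => ?_⟩
  have hv0 := mass_pos hv
  have hu := smul_mem_feasible (inv_pos.2 hv0) hv
  set u := (mass v)⁻¹ • v with hu_def
  have hu1 : mass u = 1 := by rw [hu_def, mass_smul, inv_mul_cancel₀ hv0.ne']
  have hmem : (fun x : B => u x) ∈ stdSimplex ℝ B :=
    ⟨fun x => hu.2.1 x, by rw [← hu1, mass_eq_sum hu.1]⟩
  have hle : Q p ≤ Q fun x : B => u x := hmin hmem
  have hpos : 0 < Q p := by rw [← hQ]; exact similarityForm_self_pos (hEf p hp).2.2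
  change diversityRatio v ≤ diversityRatio (E p)
  rw [← diversityRatio_smul (inv_ne_zero hv0.ne') v, ← hu_def]
  unfold diversityRatio
  rw [hu1, hm p hp, hQ, similarityForm_eq_sum hu.1]
  exact div_le_div_of_nonneg_left (by norm_num) hpos hle

theorem diversityRatio_pos {X : Type*} [MetricSpace X] [PositiveDefiniteSpace X] {B : Finset X}
    {w : X →₀ ℝ} (hw : w ∈ feasible B) : 0 < diversityRatio w :=
  div_pos (pow_pos (mass_pos hw) 2) (similarityForm_self_pos hw.2.2)

theorem finiteMaxDiversity_eq {X : Type*} [MetricSpace X] {B : Finset X} {w : X →₀ ℝ}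
    (hw : w ∈ feasible B) (hmax : IsMaxOn diversityRatio (feasible B) w) :
    finiteMaxDiversity B = diversityRatio w := by
  refine IsGreatest.csSup_eq ⟨⟨w, hw, rfl⟩, ?_⟩
  rintro _ ⟨v, hv, rfl⟩
  exact hmax hv

theorem existsUnique_isFiniteDiversifier {X : Type*} [MetricSpace X] [PositiveDefiniteSpace X]
    (B : Finset X) : ∃! w, IsFiniteDiversifier B w := by
  rcases B.eq_empty_or_nonempty with rfl | hB
  · exact ⟨0, ⟨fun h => absurd h (by simp), fun _ => rfl⟩, fun w hw => hw.2 rfl⟩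
  obtain ⟨w, hw, hmax⟩ := exists_isMaxOn hB
  have hr := diversityRatio_pos hw
  have hm := mass_pos hw
  refine existsUnique_of_exists_of_unique
    ⟨(diversityRatio w / mass w) • w, fun _ => ⟨smul_mem_feasible (div_pos hr hm) hw, ?_, ?_⟩,
      fun h => absurd h hB.ne_empty⟩ ?_
  · intro v hv
    change _ ≤ diversityRatio _
    rw [diversityRatio_smul (div_pos hr hm).ne']
    exact hmax hv
  · rw [mass_smul, div_mul_cancel₀ _ hm.ne', finiteMaxDiversity_eq hw hmax]
  · intro u v hu hv
    obtain ⟨hu, hum, hu1⟩ := hu.1 hB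
    obtain ⟨hv, hvm, hv1⟩ := hv.1 hB
    have key : ∀ z ∈ feasible B, IsMaxOn diversityRatio (feasible B) z →
        mass z = finiteMaxDiversity B → similarityForm z z = mass z := by
      intro z hz hzm hz1
      rw [finiteMaxDiversity_eq hz hzm] at hz1
      have h0 := similarityForm_self_pos hz.2.2
      have h1 := mass_pos hz
      rw [diversityRatio, eq_div_iff h0.ne'] at hz1
      nlinarith [mul_left_cancel₀ h1.ne' (hz1.trans (sq (mass z)))]
    have hQu := key u hu hum hu1
    have hQv := key v hv hvm hv1
    have hM : 0 < mass u := mass_pos hu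
    have huv : mass v = mass u := hv1.trans hu1.symm
    have hs : u + v ∈ feasible B := by
      classical
      refine ⟨Finsupp.support_add.trans (Finset.union_subset hu.1 hv.1),
        add_nonneg hu.2.1 hv.2.1, fun h => ?_⟩
      have := mass_add u v
      rw [h, huv] at this
      simp [mass] at this
      unfold mass at hM
      linarith
    have h2 : diversityRatio (u + v) ≤ diversityRatio u := hum hs
    rw [← finiteMaxDiversity_eq hu hum, ← hu1, diversityRatio,
      div_le_iff₀ (similarityForm_self_pos hs.2.2), mass_add, huv] at h2
    have h3 : 4 * mass u ≤ similarityForm (u + v) (u + v) := by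
      refine le_of_mul_le_mul_left ?_ hM
      linarith
    by_contra hne
    have h4 := similarityForm_self_pos (sub_ne_zero.2 hne)
    have e1 : u - v = u + (-1 : ℝ) • v := by rw [neg_one_smul, sub_eq_add_neg]
    rw [e1] at h4
    have expand (c : ℝ) : similarityForm (u + c • v) (u + c • v) =
        similarityForm u u + 2 * c * similarityForm u v + c ^ 2 * similarityForm v v := by
      rw [similarityForm_add_left, similarityForm_comm u, similarityForm_comm (c • v),
        similarityForm_add_left, similarityForm_add_left, similarityForm_smul_left,
        similarityForm_comm u (c • v), similarityForm_smul_left, similarityForm_smul_left,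
        similarityForm_comm v (c • v), similarityForm_smul_left, similarityForm_comm v u]
      ring
    have a1 := expand 1
    rw [one_smul] at a1
    have a2 := expand (-1)
    linarith

/-- The diversifier `w_{B,+}` of a finite subset `B`. -/
def finiteDiversifier {X : Type*} [MetricSpace X] [PositiveDefiniteSpace X] (B : Finset X) :
    X →₀ ℝ :=
  (existsUnique_isFiniteDiversifier B).choose

/-- The space `FM_X` of finitely supported signed measures `∑ w x • δ_x` on `X`. -/
def FM (X : Type*) : Type _ := X →₀ ℝ

instance {X : Type*} : AddCommGroup (FM X) := inferInstanceAs (AddCommGroup (X →₀ ℝ))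

instance {X : Type*} : Module ℝ (FM X) := inferInstanceAs (Module ℝ (X →₀ ℝ))

/-- The inner product `⟨·,·⟩_W` on `FM_X`. -/
@[reducible]
def innerCore (X : Type*) [MetricSpace X] [PositiveDefiniteSpace X] :
    InnerProductSpace.Core ℝ (FM X) where
  inner w v := similarityForm (X := X) w v
  conj_inner_symm w v := similarityForm_comm (X := X) v w
  re_inner_nonneg w := by
    by_cases h : w = 0
    · subst h
      have h0 : similarityForm (0 : X →₀ ℝ) 0 = 0 := Finsupp.sum_zero_index
      exact h0.ge
    · exact (similarityForm_self_pos (X := X) h).le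
  add_left u w v := similarityForm_add_left (X := X) u w v
  smul_left w v c := similarityForm_smul_left (X := X) c w v
  definite w h := by
    by_contra hne
    exact (similarityForm_self_pos (X := X) hne).ne' h

instance {X : Type*} [MetricSpace X] [PositiveDefiniteSpace X] : NormedAddCommGroup (FM X) :=
  (innerCore X).toNormedAddCommGroup

instance {X : Type*} [MetricSpace X] [PositiveDefiniteSpace X] : InnerProductSpace ℝ (FM X) :=
  InnerProductSpace.ofCore (innerCore X).toCore

/-- The weighting space `W_X`: the Hilbert space completion of `FM_X`. -/
abbrev WeightingSpace (X : Type*) [MetricSpace X] [PositiveDefiniteSpace X] : Type _ :=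
  UniformSpace.Completion (FM X)

/-- The canonical map from finitely supported measures to the weighting space. -/
def toWeightingSpace {X : Type*} [MetricSpace X] [PositiveDefiniteSpace X] (w : X →₀ ℝ) :
    WeightingSpace X :=
  ((show FM X from w : FM X) : UniformSpace.Completion (FM X))

/-- A finite subset of (the subspace) `A`, as a finite subset of `X`. -/
def finiteSubset {X : Type*} (A : Set X) (B : Finset A) : Finset X :=
  B.map (Function.Embedding.subtype (· ∈ A))

/-- The maximum diversity `|A|_+ ∈ [0, ∞]`: the supremum of `|B|_+` over finite `B ⊆ A`. -/
def maxDiversity {X : Type*} [MetricSpace X] (A : Set X) : ENNReal :=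
  ⨆ B : Finset A, ENNReal.ofReal (finiteMaxDiversity (finiteSubset A B))

/-- The net `(w_{B,+})`, indexed by the finite subsets `B` of `A` directed by inclusion. -/
def diversifierNet {X : Type*} [MetricSpace X] [PositiveDefiniteSpace X] (A : Set X) :
    Finset A → WeightingSpace X :=
  fun B => toWeightingSpace (finiteDiversifier (finiteSubset A B))

/-- The diversifier `w_{A,+}`: the limit in the weighting space of the net of diversifiers of
finite subsets of `A`. -/
def diversifier {X : Type*} [MetricSpace X] [PositiveDefiniteSpace X] (A : Set X) :
    WeightingSpace X :=
  Filter.limUnder Filter.atTop (diversifierNet A)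

end Diversity

end

namespace Diversity

/-! The normalization of the diversifier gives `⟨w_F, w_F⟩ = mass w_F = |F|_+`, and first-order
optimality gives `⟨w_F, v⟩ ≥ mass v` for every `v ≥ 0` on `F`
(`mass_le_similarityForm_finiteDiversifier`). For `F ⊆ G`, testing `w_G` against `w_F` bounds the
cross term below by `|F|_+`, so `‖w_G - w_F‖² ≤ |G|_+ - |F|_+` (`norm_finiteDiversifier_sub_sq_le`).
Comparing two finite sets through their union yields the stated inequality at finite level, which
passes to the limit. The same estimate makes the net of diversifiers Cauchy once `|A|_+` is finite.

Finiteness comes from compactness: if `N` unit balls cover `A`, points in one ball have similarity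
at least `e⁻²`, so Cauchy–Schwarz over the balls gives `(mass w)² ≤ N e² ⟨w, w⟩` for `w ≥ 0`. At a
diversifier this reads `|F|_+ ≤ N e²`. -/

@[simp]
theorem mass_zero {X : Type*} : mass (0 : X →₀ ℝ) = 0 := Finsupp.sum_zero_index

theorem finiteSubset_mono {X : Type*} (A : Set X) : Monotone (finiteSubset A) := fun _ _ h =>
  Finset.map_subset_map.2 h

theorem coe_finiteSubset_subset {X : Type*} (A : Set X) (F : Finset A) :
    (finiteSubset A F : Set X) ⊆ A := by
  intro x hx
  obtain ⟨y, -, rfl⟩ := Finset.mem_map.1 (Finset.mem_coe.1 hx)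
  exact y.2

/-! ### Energy of nonnegative measures and comparison of finite sets with their supersets -/

section

variable {X : Type*} [MetricSpace X]

@[simp]
theorem similarityForm_zero_left (v : X →₀ ℝ) : similarityForm 0 v = 0 := Finsupp.sum_zero_index

@[simp]
theorem similarityForm_zero_right (v : X →₀ ℝ) : similarityForm v 0 = 0 := by
  rw [similarityForm_comm, similarityForm_zero_left]

theorem similarityForm_add_smul_self (u v : X →₀ ℝ) (c : ℝ) :
    similarityForm (u + c • v) (u + c • v) =
      similarityForm u u + 2 * c * similarityForm u v + c ^ 2 * similarityForm v v := by
  rw [similarityForm_add_left, similarityForm_comm u, similarityForm_comm (c • v),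
    similarityForm_add_left, similarityForm_add_left, similarityForm_smul_left,
    similarityForm_comm u (c • v), similarityForm_smul_left, similarityForm_smul_left,
    similarityForm_comm v (c • v), similarityForm_smul_left, similarityForm_comm v u]
  ring

/-- If `c` groups the points of `F` into classes of diameter at most `2`, labelled by `t`, then
nonnegative measures on `F` have squared mass at most `#t * e²` times their energy. -/
theorem mass_sq_le_card_mul_similarityForm {Y : Type*} {F : Finset X} {t : Finset Y} {c : X → Y}
    (hc : ∀ x ∈ F, c x ∈ t) (hd : ∀ x ∈ F, ∀ y ∈ F, c x = c y → dist x y ≤ 2)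
    {w : X →₀ ℝ} (hw : w.support ⊆ F) (h0 : 0 ≤ w) :
    mass w ^ 2 ≤ t.card * Real.exp 2 * similarityForm w w := by
  classical
  have hm : mass w = ∑ j ∈ t, ∑ x ∈ F with c x = j, w x := by
    rw [Finset.sum_fiberwise_of_maps_to hc]
    exact Finsupp.sum_of_support_subset _ hw _ (by simp)
  have hsq : ∑ j ∈ t, (∑ x ∈ F with c x = j, w x) ^ 2 =
      ∑ x ∈ F, ∑ y ∈ F, if c x = c y then w x * w y else 0 := by
    rw [← Finset.sum_fiberwise_of_maps_to hc]
    refine Finset.sum_congr rfl fun j _ => ?_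
    rw [sq, Finset.sum_mul_sum]
    refine Finset.sum_congr rfl fun x hx => ?_
    rw [Finset.sum_filter]
    refine Finset.sum_congr rfl fun y _ => ?_
    rw [(Finset.mem_filter.1 hx).2]
    simp only [eq_comm]
  have hform : similarityForm w w =
      ∑ x ∈ F, ∑ y ∈ F, w x * w y * Real.exp (-dist x y) := by
    unfold similarityForm
    rw [Finsupp.sum_of_support_subset _ hw _ (by simp)]
    refine Finset.sum_congr rfl fun x _ => ?_
    rw [Finsupp.sum_of_support_subset _ hw _ (by simp)]
  have hle : ∑ j ∈ t, (∑ x ∈ F with c x = j, w x) ^ 2 ≤ Real.exp 2 * similarityForm w w := by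
    rw [hsq, hform, Finset.mul_sum]
    refine Finset.sum_le_sum fun x hx => ?_
    rw [Finset.mul_sum]
    refine Finset.sum_le_sum fun y hy => ?_
    have hxy : 0 ≤ w x * w y := mul_nonneg (h0 x) (h0 y)
    rw [mul_left_comm, ← Real.exp_add]
    -- A pair in one class has `exp (2 - dist x y) ≥ 1`. A pair in different classes contributes
    -- only to the energy, and nonnegatively.
    split_ifs with h
    · exact le_mul_of_one_le_right hxy (Real.one_le_exp (by linarith [hd x hx y hy h]))
    · positivity
  rw [hm, mul_assoc]
  exact sq_sum_le_card_mul_sum_sq.trans (mul_le_mul_of_nonneg_left hle (Nat.cast_nonneg _))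

theorem finiteMaxDiversity_empty : finiteMaxDiversity (∅ : Finset X) = 0 := by
  have : feasible (∅ : Finset X) = ∅ := by
    ext w
    simp only [feasible, Set.mem_ofPred_eq, Set.mem_empty_iff_false, iff_false]
    rintro ⟨h, -, h'⟩
    exact h' (Finsupp.support_eq_empty.1 (Finset.subset_empty.1 h))
  -- `sSup ∅ = 0` in `ℝ` agrees with the convention `|∅|_+ = 0`.
  rw [finiteMaxDiversity, this, Set.image_empty, Real.sSup_empty]

/-- The supremum runs over finite sets of the subtype `A`. This form also serves finite subsets of
`X` not given that way, such as a union of one part in `A` and one in `B`. -/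
theorem ofReal_finiteMaxDiversity_le {A : Set X} {F : Finset X} (hF : (F : Set X) ⊆ A) :
    ENNReal.ofReal (finiteMaxDiversity F) ≤ maxDiversity A := by
  classical
  have : finiteSubset A (F.subtype (· ∈ A)) = F :=
    Finset.subtype_map_of_mem fun x hx => hF hx
  exact le_iSup_of_le (F.subtype (· ∈ A)) (by rw [this])

theorem finiteMaxDiversity_le_toReal {A : Set X} (hA : maxDiversity A ≠ ⊤) {F : Finset X}
    (hF : (F : Set X) ⊆ A) : finiteMaxDiversity F ≤ (maxDiversity A).toReal :=
  (ENNReal.ofReal_le_iff_le_toReal hA).1 (ofReal_finiteMaxDiversity_le hF)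

end

/-! ### Diversifiers of finite sets -/

section

variable {X : Type*} [MetricSpace X] [PositiveDefiniteSpace X]

theorem finiteDiversifier_spec (F : Finset X) : IsFiniteDiversifier F (finiteDiversifier F) :=
  (existsUnique_isFiniteDiversifier F).choose_spec.1

theorem finiteDiversifier_empty : finiteDiversifier (∅ : Finset X) = 0 :=
  (finiteDiversifier_spec ∅).2 rfl

theorem mass_finiteDiversifier (F : Finset X) :
    mass (finiteDiversifier F) = finiteMaxDiversity F := by
  rcases F.eq_empty_or_nonempty with rfl | hF
  · rw [finiteDiversifier_empty, finiteMaxDiversity_empty, mass_zero]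
  · exact ((finiteDiversifier_spec F).1 hF).2.2

theorem support_finiteDiversifier_subset (F : Finset X) : (finiteDiversifier F).support ⊆ F := by
  rcases F.eq_empty_or_nonempty with rfl | hF
  · simp [finiteDiversifier_empty]
  · exact ((finiteDiversifier_spec F).1 hF).1.1

theorem finiteDiversifier_nonneg (F : Finset X) : 0 ≤ finiteDiversifier F := by
  rcases F.eq_empty_or_nonempty with rfl | hF
  · simp [finiteDiversifier_empty]
  · exact ((finiteDiversifier_spec F).1 hF).1.2.1

/-- The normalization says that mass equals mass squared over energy, so energy equals mass. -/
theorem similarityForm_finiteDiversifier_self (F : Finset X) :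
    similarityForm (finiteDiversifier F) (finiteDiversifier F) = finiteMaxDiversity F := by
  rcases F.eq_empty_or_nonempty with rfl | hF
  · rw [finiteDiversifier_empty, finiteMaxDiversity_empty, similarityForm_zero_left]
  · obtain ⟨hw, hmax, hm⟩ := (finiteDiversifier_spec F).1 hF
    have h := hm
    rw [finiteMaxDiversity_eq hw hmax, diversityRatio,
      eq_div_iff (similarityForm_self_pos hw.2.2).ne', sq] at h
    rw [← hm, mul_left_cancel₀ (mass_pos hw).ne' h]

/-- The first-order optimality condition for the diversifier: its potential is at least `1` on
nonnegative measures. -/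
theorem mass_le_similarityForm_finiteDiversifier {F : Finset X} {v : X →₀ ℝ}
    (hv : v.support ⊆ F) (h0 : 0 ≤ v) : mass v ≤ similarityForm (finiteDiversifier F) v := by
  classical
  rcases eq_or_ne v 0 with rfl | hne
  · simp
  have hF : F.Nonempty := (Finsupp.support_nonempty_iff.2 hne).mono hv
  obtain ⟨hw, hmax, hm⟩ := (finiteDiversifier_spec F).1 hF
  have hself := similarityForm_finiteDiversifier_self F
  rw [← hm] at hself
  have hM := mass_pos hw
  have hratio : diversityRatio (finiteDiversifier F) = mass (finiteDiversifier F) := by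
    rw [hm, finiteMaxDiversity_eq hw hmax]
  set w := finiteDiversifier F
  have hq := similarityForm_self_pos hne
  by_contra! hlt
  -- Perturb `w` to `w + t • v`. With this `t`, the quadratic cost `t² ⟨v, v⟩` is only half of the
  -- linear gain `2t (mass v - ⟨w, v⟩)`, so the ratio would exceed its maximum.
  have ht : 0 < (mass v - similarityForm w v) / similarityForm v v :=
    div_pos (sub_pos.2 hlt) hq
  set t := (mass v - similarityForm w v) / similarityForm v v with ht_def
  have htq : t * similarityForm v v = mass v - similarityForm w v := div_mul_cancel₀ _ hq.ne'
  have hmass : mass (w + t • v) = mass w + t * mass v := by rw [mass_add, mass_smul]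
  have hmem : w + t • v ∈ feasible F := by
    refine ⟨Finsupp.support_add.trans (Finset.union_subset hw.1 (Finsupp.support_smul.trans hv)),
      add_nonneg hw.2.1 (smul_nonneg ht.le h0), fun h => ?_⟩
    rw [h, mass_zero] at hmass
    linarith [mul_pos ht (mass_pos ⟨hv, h0, hne⟩)]
  have h1 : diversityRatio (w + t • v) ≤ diversityRatio w := hmax hmem
  rw [hratio, diversityRatio, div_le_iff₀ (similarityForm_self_pos hmem.2.2), hmass,
    similarityForm_add_smul_self, hself] at h1
  have h2 : t ^ 2 * similarityForm v v = t * (mass v - similarityForm w v) := by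
    rw [← htq]; ring
  rw [h2] at h1
  have h3 : 0 < mass w * (t * (mass v - similarityForm w v)) :=
    mul_pos hM (mul_pos ht (sub_pos.2 hlt))
  nlinarith [sq_nonneg (t * mass v)]

theorem norm_toWeightingSpace_sub_sq (u v : X →₀ ℝ) :
    ‖toWeightingSpace u - toWeightingSpace v‖ ^ 2 =
      similarityForm u u - 2 * similarityForm u v + similarityForm v v := by
  unfold toWeightingSpace
  rw [norm_sub_sq_real, ← real_inner_self_eq_norm_sq, ← real_inner_self_eq_norm_sq,
    UniformSpace.Completion.inner_coe, UniformSpace.Completion.inner_coe,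
    UniformSpace.Completion.inner_coe]
  rfl

/-- Expand the square: optimality of `w_G`, tested on `w_F`, gives `⟨w_G, w_F⟩ ≥ |F|_+`. -/
theorem norm_finiteDiversifier_sub_sq_le {F G : Finset X} (h : F ⊆ G) :
    ‖toWeightingSpace (finiteDiversifier G) - toWeightingSpace (finiteDiversifier F)‖ ^ 2 ≤
      finiteMaxDiversity G - finiteMaxDiversity F := by
  have h1 := mass_le_similarityForm_finiteDiversifier
    ((support_finiteDiversifier_subset F).trans h) (finiteDiversifier_nonneg F)
  rw [mass_finiteDiversifier] at h1
  rw [norm_toWeightingSpace_sub_sq, similarityForm_finiteDiversifier_self,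
    similarityForm_finiteDiversifier_self]
  linarith

theorem finiteMaxDiversity_mono : Monotone (finiteMaxDiversity (X := X)) := fun _ _ h =>
  sub_nonneg.1 ((sq_nonneg _).trans (norm_finiteDiversifier_sub_sq_le h))

theorem finiteMaxDiversity_nonneg (F : Finset X) : 0 ≤ finiteMaxDiversity F := by
  rw [← finiteMaxDiversity_empty (X := X)]
  exact finiteMaxDiversity_mono F.empty_subset

/-- The maximum diversity of a compact set is finite. -/
theorem maxDiversity_ne_top {A : Set X} (hA : IsCompact A) : maxDiversity A ≠ ⊤ := by
  obtain ⟨t, -, htf, ht⟩ := hA.finite_cover_balls one_pos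
  have hex : ∀ x ∈ A, ∃ y ∈ htf.toFinset, dist x y < 1 := fun x hx => by
    simpa using ht hx
  classical
  -- Each point of `A` is sent to the center of a unit ball containing it; the value off `A` plays
  -- no role.
  let c : X → X := fun x => if hx : x ∈ A then (hex x hx).choose else x
  have hc : ∀ x ∈ A, c x ∈ htf.toFinset ∧ dist x (c x) < 1 := fun x hx => by
    simpa only [c, dif_pos hx] using (hex x hx).choose_spec
  refine ne_top_of_le_ne_top
    (ENNReal.ofReal_ne_top (r := htf.toFinset.card * Real.exp 2)) (iSup_le fun F => ?_)
  refine ENNReal.ofReal_le_ofReal ?_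
  have hF := coe_finiteSubset_subset A F
  set G := finiteSubset A F
  have h := mass_sq_le_card_mul_similarityForm (c := c) (fun x hx => (hc x (hF hx)).1)
    (fun x hx y hy hxy => by
      have h1 := (hc x (hF hx)).2
      have h2 := (hc y (hF hy)).2
      rw [← hxy] at h2
      linarith [dist_triangle_right x y (c x)])
    (support_finiteDiversifier_subset G) (finiteDiversifier_nonneg G)
  rw [mass_finiteDiversifier, similarityForm_finiteDiversifier_self, sq] at h
  -- `h` is now `|G|_+² ≤ N e² |G|_+`; a factor cancels unless it is zero.
  rcases (finiteMaxDiversity_nonneg G).eq_or_lt with h0 | h0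
  · rw [← h0]; positivity
  · exact le_of_mul_le_mul_right h h0

/-! ### Limits over the finite subsets -/

theorem tendsto_finiteMaxDiversity {A : Set X} (hA : maxDiversity A ≠ ⊤) :
    Filter.Tendsto (fun F => finiteMaxDiversity (finiteSubset A F)) Filter.atTop
      (nhds (maxDiversity A).toReal) := by
  have hmono : Monotone fun F => ENNReal.ofReal (finiteMaxDiversity (finiteSubset A F)) :=
    fun _ _ h => ENNReal.ofReal_le_ofReal (finiteMaxDiversity_mono (finiteSubset_mono A h))
  refine ((ENNReal.tendsto_toReal hA).comp (tendsto_atTop_iSup hmono)).congr fun F => ?_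
  exact ENNReal.toReal_ofReal (finiteMaxDiversity_nonneg _)

/-- Triangle inequality through the diversifier of `F ∪ G`, whose diversity is at most `|C|_+`.
Taking `C = A` gives the Cauchy property, and `C = A ∪ B` the final bound. -/
theorem norm_finiteDiversifier_sub_le {C : Set X} (hC : maxDiversity C ≠ ⊤) {F G : Finset X}
    (hFC : (F : Set X) ⊆ C) (hGC : (G : Set X) ⊆ C) :
    ‖toWeightingSpace (finiteDiversifier F) - toWeightingSpace (finiteDiversifier G)‖ ≤
      √((maxDiversity C).toReal - finiteMaxDiversity F) +
      √((maxDiversity C).toReal - finiteMaxDiversity G) := by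
  classical
  have hU : finiteMaxDiversity (F ∪ G) ≤ (maxDiversity C).toReal :=
    finiteMaxDiversity_le_toReal hC (by rw [Finset.coe_union]; exact Set.union_subset hFC hGC)
  have key : ∀ H ⊆ F ∪ G,
      ‖toWeightingSpace (finiteDiversifier (F ∪ G)) - toWeightingSpace (finiteDiversifier H)‖ ≤
        √((maxDiversity C).toReal - finiteMaxDiversity H) := fun H hH =>
    Real.le_sqrt_of_sq_le ((norm_finiteDiversifier_sub_sq_le hH).trans
      (sub_le_sub_right hU _))
  refine (norm_sub_le_norm_sub_add_norm_sub _
    (toWeightingSpace (finiteDiversifier (F ∪ G))) _).trans (add_le_add ?_ ?_)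
  · rw [norm_sub_rev]
    exact key F Finset.subset_union_left
  · exact key G Finset.subset_union_right

theorem tendsto_sqrt_sub_finiteMaxDiversity {A : Set X} (hA : maxDiversity A ≠ ⊤) (r : ℝ) :
    Filter.Tendsto (fun F => √(r - finiteMaxDiversity (finiteSubset A F))) Filter.atTop
      (nhds √(r - (maxDiversity A).toReal)) :=
  ((tendsto_finiteMaxDiversity hA).const_sub r).sqrt

theorem tendsto_diversifierNet {A : Set X} (hA : maxDiversity A ≠ ⊤) :
    Filter.Tendsto (diversifierNet A) Filter.atTop (nhds (diversifier A)) := by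
  refine tendsto_nhds_limUnder (cauchy_map_iff_exists_tendsto.1 ?_)
  rw [cauchy_map_iff]
  refine ⟨Filter.atTop_neBot, ?_⟩
  rw [tendsto_uniformity_iff_dist_tendsto_zero]
  -- With `r = |A|_+` both square roots tend to `0`.
  have h := tendsto_sqrt_sub_finiteMaxDiversity hA (maxDiversity A).toReal
  rw [sub_self, Real.sqrt_zero] at h
  have h2 := (h.comp Filter.tendsto_fst).add (h.comp (Filter.tendsto_snd (f := Filter.atTop)))
  rw [add_zero] at h2
  refine squeeze_zero (fun _ => dist_nonneg) (fun p => ?_) h2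
  rw [dist_eq_norm]
  exact norm_finiteDiversifier_sub_le hA (coe_finiteSubset_subset A _)
    (coe_finiteSubset_subset A _)

theorem norm_diversifier_sub_le {A B : Set X} (hA : maxDiversity A ≠ ⊤) (hB : maxDiversity B ≠ ⊤)
    (hAB : maxDiversity (A ∪ B) ≠ ⊤) :
    ‖diversifier A - diversifier B‖ ≤
      √((maxDiversity (A ∪ B)).toReal - (maxDiversity A).toReal) +
      √((maxDiversity (A ∪ B)).toReal - (maxDiversity B).toReal) := by
  -- The finite subsets of `A` and of `B` vary independently, so the limit is taken along the
  -- product filter.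
  have hl := (((tendsto_diversifierNet hA).comp Filter.tendsto_fst).sub
    ((tendsto_diversifierNet hB).comp Filter.tendsto_snd)).norm
  have hr := ((tendsto_sqrt_sub_finiteMaxDiversity hA (maxDiversity (A ∪ B)).toReal).comp
    Filter.tendsto_fst).add ((tendsto_sqrt_sub_finiteMaxDiversity hB
      (maxDiversity (A ∪ B)).toReal).comp Filter.tendsto_snd)
  exact le_of_tendsto_of_tendsto' hl hr fun p => norm_finiteDiversifier_sub_le hAB
    ((coe_finiteSubset_subset A _).trans Set.subset_union_left)
    ((coe_finiteSubset_subset B _).trans Set.subset_union_right)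

end

end Diversity

theorem mainTheorem5 {X : Type*} [MetricSpace X] [Diversity.PositiveDefiniteSpace X]
    (A B : Set X) (hA : IsCompact A) (hB : IsCompact B) :
    -- the maximum diversities are finite
    Diversity.maxDiversity A ≠ ⊤ ∧ Diversity.maxDiversity B ≠ ⊤ ∧ Diversity.maxDiversity (A ∪ B) ≠ ⊤ ∧
    -- the limits that define the diversifiers exist
    Filter.Tendsto (Diversity.diversifierNet A) Filter.atTop (nhds (Diversity.diversifier A)) ∧
    Filter.Tendsto (Diversity.diversifierNet B) Filter.atTop (nhds (Diversity.diversifier B)) ∧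
    ‖Diversity.diversifier A - Diversity.diversifier B‖ ≤
      √((Diversity.maxDiversity (A ∪ B)).toReal - (Diversity.maxDiversity A).toReal) +
      √((Diversity.maxDiversity (A ∪ B)).toReal - (Diversity.maxDiversity B).toReal) := by
  have hA' := Diversity.maxDiversity_ne_top hA
  have hB' := Diversity.maxDiversity_ne_top hB
  have hAB := Diversity.maxDiversity_ne_top (hA.union hB)
  exact ⟨hA', hB', hAB, Diversity.tendsto_diversifierNet hA', Diversity.tendsto_diversifierNet hB',
    Diversity.norm_diversifier_sub_le hA' hB' hAB⟩
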